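/- Let $\mathcal{H}$ and $\mathcal{K}$ be Hilbert spaces over the same field $\mathbb{R}$ or $\mathbb{C}$, and let $\mathcal{B}(\mathcal{H},\mathcal{K})$ be the set of bounded linear operators from $\mathcal{H}$ to $\mathcal{K}$. For $A,C\in\mathcal{B}(\mathcal{H},\mathcal{K})$ write $A\overset{*}{\leq}C$ (the star partial order) if $AA^*=CA^*$ and $A^*A=A^*C$. A star-supremum of $A,B\in\mathcal{B}(\mathcal{H},\mathcal{K})$ is a least upper bound of $A$ and $B$ for this order, that is, an operator $S\in\mathcal{B}(\mathcal{H},\mathcal{K})$ with $A\overset{*}{\leq}S$ and $B\overset{*}{\leq}S$, such that $S\overset{*}{\leq}D$ for every $D\in\mathcal{B}(\mathcal{H},\mathcal{K})$ with $A\overset{*}{\leq}D$ and $B\overset{*}{\leq}D$. Let $A,B\in\mathcal{B}(\mathcal{H},\mathcal{K})$ be such that the range $\mathcal{R}(A-B)$ is closed in $\mathcal{K}$. Then the star-supremum of $A$ and $B$ exists if and only if $$AA^*B=AB^*B\quad\text{and}\quad BA^*A=BB^*A.$$ -/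

import Mathlib

open scoped InnerProduct

/-- Drazin's star partial order on bounded operators between Hilbert spaces:
`A` is below `C` when `A A* = C A*` and `A* A = A* C`. -/
def StarLE {𝕜 H K : Type*} [RCLike 𝕜]
    [NormedAddCommGroup H] [InnerProductSpace 𝕜 H] [CompleteSpace H]
    [NormedAddCommGroup K] [InnerProductSpace 𝕜 K] [CompleteSpace K]
    (A C : H →L[𝕜] K) : Prop :=
  A ∘L A† = C ∘L A† ∧ A† ∘L A = A† ∘L C

/-- `S` is the star-supremum of `A` and `B`: the least upper bound of `A` and `B`
for the star partial order. -/
def IsStarSup {𝕜 H K : Type*} [RCLike 𝕜]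
    [NormedAddCommGroup H] [InnerProductSpace 𝕜 H] [CompleteSpace H]
    [NormedAddCommGroup K] [InnerProductSpace 𝕜 K] [CompleteSpace K]
    (A B S : H →L[𝕜] K) : Prop :=
  StarLE A S ∧ StarLE B S ∧
    ∀ D : H →L[𝕜] K, StarLE A D → StarLE B D → StarLE S D

/-!
If `D` is a common upper bound of a family of operators for the star order, cutting `D` down to the
closed span of the ranges of the adjoints gives the least one, so suprema exist as soon as upper
bounds do. An upper bound `D` of `A` and `B` forces `A A* B = A D* B = A B* B`. Conversely, put
`T = A - B`. The two identities say that `B* T A* = 0` and `A* T B* = 0`, and closedness of the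
range of `T` provides `Q` with `T T* Q = T`. Then `D = A + T B* Q` is a common upper bound: it also
equals `B + T A* Q`, so it treats `A` and `B` symmetrically, and `T* T B* = B* T T*` gives
`T* T B* Q A* = B* T T* Q A* = B* T A* = 0`, whence `T B* Q A* = 0`.
-/

section ClosedRange

variable {𝕜 H K : Type*} [RCLike 𝕜]
    [NormedAddCommGroup H] [InnerProductSpace 𝕜 H] [CompleteSpace H]

theorem comp_starProjection_orthogonal_of_le_ker [NormedAddCommGroup K] [NormedSpace 𝕜 K]
    {T : H →L[𝕜] K} {U : Submodule 𝕜 H} (hU : U ≤ T.ker) : T ∘L Uᗮ.starProjection = T := by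
  have : CompleteSpace T.ker := T.isClosed_ker.completeSpace_coe
  ext x
  have hx : x - Uᗮ.starProjection x ∈ T.ker := by
    rw [← T.ker.orthogonal_orthogonal]
    exact Submodule.orthogonal_le (Submodule.orthogonal_le hU)
      (Submodule.sub_starProjection_mem_orthogonal x)
  exact (sub_eq_zero.mp ((map_sub T _ _).symm.trans hx)).symm

variable [NormedAddCommGroup K] [InnerProductSpace 𝕜 K] [CompleteSpace K]

theorem exists_comp_eq_starProjection_orthogonal_ker {T : H →L[𝕜] K}
    (hT : IsClosed (Set.range T)) :
    ∃ R : K →L[𝕜] H, R ∘L T = T.kerᗮ.starProjection := by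
  have hT_proj : T ∘L T.kerᗮ.starProjection = T := comp_starProjection_orthogonal_of_le_ker le_rfl
  set f : T.kerᗮ →L[𝕜] K := T ∘L T.kerᗮ.subtypeL
  have hf_inj : Function.Injective f := by
    refine (injective_iff_map_eq_zero f).mpr fun x hx ↦ ?_
    exact Subtype.ext (inner_self_eq_zero.mp (Submodule.inner_right_of_mem_orthogonal hx x.2))
  have hf_range : Set.range f = Set.range T := by
    refine (Set.range_comp_subset_range _ T).antisymm ?_
    rintro _ ⟨x, rfl⟩
    exact ⟨T.kerᗮ.orthogonalProjectionOnto x, congr($hT_proj x)⟩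
  have hf_closed : IsClosed (Set.range f) := hf_range ▸ hT
  have : CompleteSpace f.range := hf_closed.completeSpace_coe
  obtain ⟨g, hg⟩ :=
    ContinuousLinearMap.HasLeftInverse.of_injective_of_isClosed_range_of_closedComplement_range
      hf_inj hf_closed
      ⟨f.range.orthogonalProjectionOnto, Submodule.orthogonalProjectionOnto_mem_subspace_eq_self⟩
  refine ⟨T.kerᗮ.subtypeL ∘L g, ContinuousLinearMap.ext fun x ↦ ?_⟩
  calc (g (T x) : H) = g (f (T.kerᗮ.orthogonalProjectionOnto x)) :=
        congr((g $(congr($hT_proj x)) : H)).symm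
    _ = T.kerᗮ.starProjection x := by rw [hg]; rfl

theorem exists_comp_adjoint_comp_eq_self {T : H →L[𝕜] K} (hT : IsClosed (Set.range T)) :
    ∃ Q : H →L[𝕜] K, T ∘L T† ∘L Q = T := by
  obtain ⟨R, hR⟩ := exists_comp_eq_starProjection_orthogonal_ker hT
  refine ⟨R†, ?_⟩
  rw [← ContinuousLinearMap.adjoint_comp, hR, (isSelfAdjoint_starProjection _).adjoint_eq]
  exact comp_starProjection_orthogonal_of_le_ker le_rfl

end ClosedRange

section SupportProj

variable {𝕜 H K L : Type*} [RCLike 𝕜]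
    [NormedAddCommGroup H] [InnerProductSpace 𝕜 H] [CompleteSpace H]

section NormedSpace

variable [NormedAddCommGroup K] [NormedSpace 𝕜 K] {𝒜 : Set (H →L[𝕜] K)} {A : H →L[𝕜] K}

/-- The joint support projection of a family of operators: the orthogonal projection onto the
orthogonal complement of their common kernel. For operators between Hilbert spaces this is the
closed span of the ranges of their adjoints, on which all star-upper bounds of the family agree. -/
noncomputable def supportProj (𝒜 : Set (H →L[𝕜] K)) : H →L[𝕜] H :=
  (⨅ A ∈ 𝒜, A.ker)ᗮ.starProjection

theorem adjoint_supportProj (𝒜 : Set (H →L[𝕜] K)) : (supportProj 𝒜)† = supportProj 𝒜 :=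
  (isSelfAdjoint_starProjection _).adjoint_eq

theorem supportProj_comp_self (𝒜 : Set (H →L[𝕜] K)) :
    supportProj 𝒜 ∘L supportProj 𝒜 = supportProj 𝒜 :=
  Submodule.isIdempotentElem_starProjection _

theorem comp_supportProj (hA : A ∈ 𝒜) : A ∘L supportProj 𝒜 = A :=
  comp_starProjection_orthogonal_of_le_ker (iInf₂_le A hA)

end NormedSpace

variable [NormedAddCommGroup K] [InnerProductSpace 𝕜 K] [CompleteSpace K]
    [NormedAddCommGroup L] [InnerProductSpace 𝕜 L] [CompleteSpace L]
    {𝒜 : Set (H →L[𝕜] K)} {A : H →L[𝕜] K} {V W : H →L[𝕜] L}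

theorem supportProj_comp_adjoint (hA : A ∈ 𝒜) : supportProj 𝒜 ∘L A† = A† := by
  rw [← adjoint_supportProj, ← ContinuousLinearMap.adjoint_comp, comp_supportProj hA]

theorem comp_supportProj_eq_zero (hW : ∀ A ∈ 𝒜, W ∘L A† = 0) : W ∘L supportProj 𝒜 = 0 := by
  have h_range : (W†).range ≤ ⨅ A ∈ 𝒜, A.ker := by
    refine le_iInf₂ fun A hA ↦ LinearMap.range_le_ker_iff.mpr ?_
    have hAW : A ∘L W† = 0 := by
      simpa [ContinuousLinearMap.adjoint_comp] using congr(($(hW A hA))†)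
    exact congr(($hAW).toLinearMap)
  have h_ker : (⨅ A ∈ 𝒜, A.ker)ᗮ ≤ W.ker := by
    simpa [ContinuousLinearMap.orthogonal_range] using Submodule.orthogonal_le h_range
  ext x
  exact h_ker (Submodule.starProjection_apply_mem _ x)

theorem comp_supportProj_congr (h : ∀ A ∈ 𝒜, V ∘L A† = W ∘L A†) :
    V ∘L supportProj 𝒜 = W ∘L supportProj 𝒜 := by
  rw [← sub_eq_zero, ← ContinuousLinearMap.sub_comp]
  refine comp_supportProj_eq_zero fun A hA ↦ ?_
  rw [ContinuousLinearMap.sub_comp, h A hA, sub_self]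

end SupportProj

section StarOrder

variable {𝕜 H K : Type*} [RCLike 𝕜]
    [NormedAddCommGroup H] [InnerProductSpace 𝕜 H] [CompleteSpace H]
    [NormedAddCommGroup K] [InnerProductSpace 𝕜 K] [CompleteSpace K]
    {A B C D Q T : H →L[𝕜] K} {𝒜 : Set (H →L[𝕜] K)}

theorem StarLE.comp_adjoint_eq (h : StarLE A C) : A ∘L A† = A ∘L C† := by
  simpa only [ContinuousLinearMap.adjoint_comp, ContinuousLinearMap.adjoint_adjoint]
    using congr(($(h.1))†)

theorem StarLE.adjoint_comp_eq (h : StarLE A C) : A† ∘L A = C† ∘L A := by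
  simpa only [ContinuousLinearMap.adjoint_comp, ContinuousLinearMap.adjoint_adjoint]
    using congr(($(h.2))†)

theorem StarLE.comp_adjoint_comp_eq (hA : StarLE A D) (hB : StarLE B D) :
    A ∘L A† ∘L B = A ∘L B† ∘L B := by
  rw [← ContinuousLinearMap.comp_assoc, hA.comp_adjoint_eq, hB.adjoint_comp_eq,
    ContinuousLinearMap.comp_assoc]

theorem StarLE.starLE_comp_supportProj (h : StarLE A D) (hA : A ∈ 𝒜) :
    StarLE A (D ∘L supportProj 𝒜) := by
  constructor
  · rw [ContinuousLinearMap.comp_assoc, supportProj_comp_adjoint hA, h.1]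
  · rw [← ContinuousLinearMap.comp_assoc, ← h.2, ContinuousLinearMap.comp_assoc,
      comp_supportProj hA]

theorem comp_supportProj_starLE (hD : ∀ A ∈ 𝒜, StarLE A D) (hC : ∀ A ∈ 𝒜, StarLE A C) :
    StarLE (D ∘L supportProj 𝒜) C := by
  set P := supportProj 𝒜 with hP
  set S := D ∘L P with hS
  have hSP : S ∘L P = S := by
    rw [hS, ContinuousLinearMap.comp_assoc, hP, supportProj_comp_self]
  have hPS : P ∘L S† = S† := by
    rw [hP, ← adjoint_supportProj, ← ContinuousLinearMap.adjoint_comp, ← hP, hSP]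
  have hSC : S = C ∘L P :=
    comp_supportProj_congr fun A hA ↦ (hD A hA).1.symm.trans (hC A hA).1
  have h_adj : S† ∘L S = C† ∘L S := by
    suffices (S† ∘L S) ∘L P = (C† ∘L S) ∘L P by
      simpa only [ContinuousLinearMap.comp_assoc, hSP] using this
    refine comp_supportProj_congr fun A hA ↦ ?_
    have hAS : StarLE A S := (hD A hA).starLE_comp_supportProj hA
    calc (S† ∘L S) ∘L A† = S† ∘L A ∘L A† := by rw [ContinuousLinearMap.comp_assoc, ← hAS.1]
      _ = C† ∘L A ∘L A† := by
        rw [← ContinuousLinearMap.comp_assoc, ← hAS.adjoint_comp_eq, (hC A hA).adjoint_comp_eq,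
          ContinuousLinearMap.comp_assoc]
      _ = (C† ∘L S) ∘L A† := by rw [ContinuousLinearMap.comp_assoc, ← hAS.1]
  constructor
  · calc S ∘L S† = C ∘L P ∘L S† := by rw [← ContinuousLinearMap.comp_assoc, ← hSC]
      _ = C ∘L S† := by rw [hPS]
  · simpa only [ContinuousLinearMap.adjoint_comp, ContinuousLinearMap.adjoint_adjoint]
      using congr(($h_adj)†)

theorem isStarSup_comp_supportProj (hA : StarLE A D) (hB : StarLE B D) :
    IsStarSup A B (D ∘L supportProj {A, B}) :=
  ⟨hA.starLE_comp_supportProj (by simp), hB.starLE_comp_supportProj (by simp),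
    fun _ hAC hBC ↦ comp_supportProj_starLE (by simp [hA, hB]) (by simp [hAC, hBC])⟩

theorem starLE_add_comp_comp {X : K →L[𝕜] H}
    (hAX : A† ∘L T ∘L X = 0) (hXA : X ∘L T ∘L A† = 0) (hX : T† ∘L T ∘L X = X ∘L T ∘L T†)
    (hQ : T ∘L T† ∘L Q = T) :
    StarLE A (A + T ∘L X ∘L Q) := by
  have h_left : A† ∘L T ∘L X ∘L Q = 0 :=
    calc A† ∘L T ∘L X ∘L Q = (A† ∘L T ∘L X) ∘L Q := rfl
      _ = 0 := by rw [hAX, ContinuousLinearMap.zero_comp]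
  have h_adj_right : T† ∘L T ∘L X ∘L Q ∘L A† = 0 :=
    calc T† ∘L T ∘L X ∘L Q ∘L A† = (T† ∘L T ∘L X) ∘L Q ∘L A† := rfl
      _ = (X ∘L T ∘L T†) ∘L Q ∘L A† := by rw [hX]
      _ = X ∘L (T ∘L T† ∘L Q) ∘L A† := rfl
      _ = 0 := by rw [hQ, hXA]
  have h_right : T ∘L X ∘L Q ∘L A† = 0 := by
    ext y
    have hy : (X ∘L Q ∘L A†) y ∈ (T† ∘L T).ker := congr($h_adj_right y)
    rwa [ContinuousLinearMap.ker_adjoint_comp_self] at hy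
  constructor
  · rw [ContinuousLinearMap.add_comp, ContinuousLinearMap.comp_assoc,
      ContinuousLinearMap.comp_assoc, h_right, add_zero]
  · rw [ContinuousLinearMap.comp_add, h_left, add_zero]

theorem exists_starLE_starLE (h_closed : IsClosed (Set.range (A - B)))
    (hA : A ∘L A† ∘L B = A ∘L B† ∘L B) (hB : B ∘L A† ∘L A = B ∘L B† ∘L A) :
    ∃ D : H →L[𝕜] K, StarLE A D ∧ StarLE B D := by
  obtain ⟨Q, hQ⟩ := exists_comp_adjoint_comp_eq_self h_closed
  set T := A - B with hT
  have hT_adj : T† = A† - B† := map_sub _ _ _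
  have hBA : B† ∘L T ∘L A† = 0 := by
    simpa [hT, ContinuousLinearMap.adjoint_comp, ContinuousLinearMap.comp_assoc, sub_eq_zero]
      using congr(($hA)†)
  have hAB : A† ∘L T ∘L B† = 0 := by
    simpa [hT, ContinuousLinearMap.adjoint_comp, ContinuousLinearMap.comp_assoc, sub_eq_zero]
      using congr(($hB)†)
  have hTA : T† ∘L T ∘L A† = A† ∘L T ∘L T† := by
    simp only [hT_adj, ContinuousLinearMap.sub_comp, ContinuousLinearMap.comp_sub, hAB, hBA]
  have hTB : T† ∘L T ∘L B† = B† ∘L T ∘L T† := by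
    simp only [hT_adj, ContinuousLinearMap.sub_comp, ContinuousLinearMap.comp_sub, hAB, hBA]
  have h_symm : A + T ∘L B† ∘L Q = B + T ∘L A† ∘L Q := by
    have h_sub : T ∘L A† ∘L Q - T ∘L B† ∘L Q = A - B := by
      rw [← ContinuousLinearMap.comp_sub, ← ContinuousLinearMap.sub_comp, ← hT_adj, hQ]
    rw [add_comm B, sub_eq_sub_iff_add_eq_add.mp h_sub]
  refine ⟨A + T ∘L B† ∘L Q, starLE_add_comp_comp hAB hBA hTB hQ, ?_⟩
  exact h_symm ▸ starLE_add_comp_comp hBA hAB hTA hQ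

end StarOrder

theorem lemma5p9 {𝕜 H K : Type*} [RCLike 𝕜]
    [NormedAddCommGroup H] [InnerProductSpace 𝕜 H] [CompleteSpace H]
    [NormedAddCommGroup K] [InnerProductSpace 𝕜 K] [CompleteSpace K]
    (A B : H →L[𝕜] K) (hAB : IsClosed (Set.range (A - B))) :
    (∃ S : H →L[𝕜] K, IsStarSup A B S) ↔
      (A ∘L A† ∘L B = A ∘L B† ∘L B ∧ B ∘L A† ∘L A = B ∘L B† ∘L A) := by
  constructor
  · rintro ⟨S, hA, hB, -⟩
    exact ⟨hA.comp_adjoint_comp_eq hB, (hB.comp_adjoint_comp_eq hA).symm⟩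
  · rintro ⟨h₁, h₂⟩
    obtain ⟨D, hA, hB⟩ := exists_starLE_starLE hAB h₁ h₂
    exact ⟨_, isStarSup_comp_supportProj hA hB⟩
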